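/- **Theorem 1.1.** For every complex number $s$ with $\operatorname{Re} s>1$, the series $$M(s)=\sum_{n=1}^{\infty}\frac{e^{-n}}{n^{s}}\left(1+n+\frac{n^2}{2!}+\cdots+\frac{n^n}{n!}\right)$$ converges absolutely, the integral below converges absolutely, and $$\frac12\,\Gamma(1+s)\,M(s)=\int_{0}^{1}\frac{\bigl(-t-\ln(1-t)\bigr)^{s}}{t^{3}}\,dt .$$ Here, for real $a>0$, $a^s=e^{s\ln a}$ with the real logarithm (note that $-t-\ln(1-t)>0$ for $0<t<1$). -/

import Mathlib

/-- The `n`-th term `e^{-n} / n^s * (1 + n + n^2/2! + ... + n^n/n!)` of the Dirichlet series. -/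
noncomputable def MTerm (s : ℂ) (n : ℕ) : ℂ :=
  ((Real.exp (-(n : ℝ)) : ℝ) : ℂ) / (n : ℂ) ^ s *
    ∑ k ∈ Finset.range (n + 1), (n : ℂ) ^ k / (k.factorial : ℂ)

/-- `M(s)`, the sum of the terms over the positive integers. -/
noncomputable def MFun (s : ℂ) : ℂ := ∑' n : ℕ+, MTerm s n

/-! Write c_n = `truncExp n`. Since Γ(1+s)/n^(1+s) = ∫ x^s e^(-nx) dx over x > 0, Γ(1+s) M(s) is the
Mellin integral of x^s ∑ n c_n e^(-n(1+x)); c_n ≤ e^n and Re s > 1 give the absolute convergence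
that permits the interchange. Put x = -t - log(1-t) and y = 1-t: then e^(-1-x) = y e^(-y), and
`tsum_mul_truncExp` sums the series to 2y/(1-y)^4 = 2(1-t)/t^4. The Jacobian t/(1-t) leaves
2x^s/t^3. That generating identity is proved near y = 0 by expanding e^(-ny) and comparing powers of
y, then continued analytically. -/

open Finset in
/-- The partial sum `1 + n + n^2/2! + ... + n^n/n!` of the exponential series. -/
noncomputable def truncExp (n : ℕ) : ℝ := ∑ k ∈ range (n + 1), (n : ℝ) ^ k / k.factorial

lemma truncExp_nonneg (n : ℕ) : 0 ≤ truncExp n := by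
  unfold truncExp; positivity

lemma truncExp_le_exp (n : ℕ) : truncExp n ≤ Real.exp n :=
  Real.sum_le_exp_of_nonneg n.cast_nonneg _

/-! ### Finite identities for the coefficients -/

-- Up to the factor N!, this is the N-th forward difference of x^N at j, which equals N!.
open Finset in
lemma sum_alternating_pow_div_factorial (N j : ℕ) :
    ∑ i ∈ range (N + 1), ((j + i : ℕ) : ℝ) ^ i / i.factorial *
      ((-((j + i : ℕ) : ℝ)) ^ (N - i) / (N - i).factorial) = 1 := by
  have h := congrFun (fwdDiff_iter_eq_factorial (R := ℝ) (n := N)) (j : ℝ)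
  rw [fwdDiff_iter_eq_sum_shift] at h
  have hN : (N.factorial : ℝ) ≠ 0 := by positivity
  have h2 : ∀ i ∈ range (N + 1), ((j + i : ℕ) : ℝ) ^ i / i.factorial *
      ((-((j + i : ℕ) : ℝ)) ^ (N - i) / (N - i).factorial) =
      (((-1 : ℤ) ^ (N - i) * N.choose i) • ((j : ℝ) + i • (1 : ℝ)) ^ N) / N.factorial := by
    intro i hi
    have hi' : i ≤ N := by simpa [Nat.lt_succ_iff] using hi
    rw [neg_pow, zsmul_eq_mul]
    push_cast
    rw [Nat.cast_choose ℝ hi', nsmul_eq_mul, mul_one]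
    have e : ((j : ℝ) + i) ^ N = (j + i : ℝ) ^ i * (j + i : ℝ) ^ (N - i) := by
      rw [← pow_add]; congr 1; omega
    rw [e]
    field_simp
  rw [sum_congr rfl h2, ← sum_div, h]
  simp [hN]

-- Reverse c_n and swap the sums: each j ≤ m contributes 1, by the previous identity with N = m - j.
open Finset in
lemma sum_truncExp_mul_neg_pow (m : ℕ) :
    ∑ n ∈ range (m + 1), truncExp n * ((-(n : ℝ)) ^ (m - n) / (m - n).factorial) = m + 1 := by
  have h1 : ∀ n ∈ range (m + 1), truncExp n * ((-(n : ℝ)) ^ (m - n) / (m - n).factorial) =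
      ∑ j ∈ range (m + 1), if j ≤ n then (n : ℝ) ^ (n - j) / (n - j).factorial *
        ((-(n : ℝ)) ^ (m - n) / (m - n).factorial) else 0 := by
    intro n hn
    have hn' : n ≤ m := by simpa [Nat.lt_succ_iff] using hn
    rw [truncExp, ← sum_range_reflect, sum_mul, ← sum_filter]
    have : (range (m + 1)).filter (· ≤ n) = range (n + 1) := by
      ext j; simp; omega
    rw [this]
    refine sum_congr rfl fun j hj => ?_
    simp
  rw [sum_congr rfl h1, sum_comm]
  have h2 : ∀ j ∈ range (m + 1), (∑ n ∈ range (m + 1), if j ≤ n then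
      (n : ℝ) ^ (n - j) / (n - j).factorial *
        ((-(n : ℝ)) ^ (m - n) / (m - n).factorial) else 0) = 1 := by
    intro j hj
    have hj' : j ≤ m := by simpa [Nat.lt_succ_iff] using hj
    rw [← sum_filter]
    have : (range (m + 1)).filter (j ≤ ·) = Ico j (m + 1) := by
      ext n; simp; omega
    rw [this, sum_Ico_eq_sum_range, ← sum_alternating_pow_div_factorial (m - j) j]
    have e : m + 1 - j = m - j + 1 := by omega
    rw [e]
    refine sum_congr rfl fun i hi => ?_
    rw [Nat.add_sub_cancel_left, Nat.sub_add_eq]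
  rw [sum_congr rfl h2]
  simp

-- Split m + 1 = n + (m + 1 - n): the second factor cancels into the factorial, so consecutive sums
-- differ by (m+1)(m+2).
open Finset in
lemma sum_mul_truncExp_mul_neg_pow (m : ℕ) :
    ∑ n ∈ range (m + 1), (n : ℝ) * truncExp n * ((-(n : ℝ)) ^ (m - n) / (m - n).factorial) =
      (m : ℝ) * (m + 1) * (m + 2) / 3 := by
  induction m with
  | zero => simp
  | succ m ih =>
    have key : ((m + 1 : ℕ) : ℝ) * ∑ n ∈ range (m + 1 + 1),
          truncExp n * ((-(n : ℝ)) ^ (m + 1 - n) / (m + 1 - n).factorial) =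
        ∑ n ∈ range (m + 1 + 1),
          (n : ℝ) * truncExp n * ((-(n : ℝ)) ^ (m + 1 - n) / (m + 1 - n).factorial) -
        ∑ n ∈ range (m + 1),
          (n : ℝ) * truncExp n * ((-(n : ℝ)) ^ (m - n) / (m - n).factorial) := by
      rw [sum_range_succ _ (m + 1), sum_range_succ _ (m + 1), mul_add, mul_sum, add_sub_right_comm,
        ← sum_sub_distrib]
      congr 1
      · refine sum_congr rfl fun n hn => ?_
        have hn' : n ≤ m := by simpa [Nat.lt_succ_iff] using hn
        obtain ⟨k, rfl⟩ := Nat.exists_eq_add_of_le hn'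
        have e1 : n + k + 1 - n = k + 1 := by omega
        have e2 : n + k - n = k := by omega
        rw [e1, e2, Nat.factorial_succ, pow_succ]
        push_cast
        field_simp
        ring
      · simp
    rw [sum_truncExp_mul_neg_pow, ih] at key
    push_cast at key ⊢
    linarith

/-! ### The generating function -/

lemma summable_mul_truncExp_mul_pow {r : ℝ} (h0 : 0 ≤ r) (hr : Real.exp 1 * r < 1) :
    Summable fun n : ℕ => (n : ℝ) * truncExp n * r ^ n := by
  have h1 : ‖Real.exp 1 * r‖ < 1 := by
    rw [Real.norm_of_nonneg (by positivity)]; exact hr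
  refine Summable.of_nonneg_of_le
    (fun n => mul_nonneg (mul_nonneg n.cast_nonneg (truncExp_nonneg n)) (by positivity))
    (fun n => ?_) (summable_pow_mul_geometric_of_norm_lt_one 1 h1)
  rw [mul_pow, ← Real.exp_nat_mul, mul_one, pow_one, mul_assoc]
  gcongr
  exact truncExp_le_exp n

lemma hasSum_cubic_mul_geometric {y : ℝ} (hy : |y| < 1) :
    HasSum (fun m : ℕ => (m : ℝ) * (m + 1) * (m + 2) / 3 * y ^ m) (2 * y / (1 - y) ^ 4) := by
  have h := (hasSum_choose_mul_geometric_of_norm_lt_one 3 (r := y) hy).mul_left (2 * y)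
  -- The term m = 0 vanishes; after the shift the coefficient is 2 · C(m+3, 3).
  rw [← hasSum_nat_add_iff' 1]
  simp only [Finset.range_one, Finset.sum_singleton, Nat.cast_zero, zero_mul, zero_div, sub_zero]
  convert! h using 1
  · ext m
    have : ((m + 3).choose 3 : ℝ) * 6 = (m + 1) * (m + 2) * (m + 3) := by
      have h3 := Nat.descFactorial_eq_factorial_mul_choose (m + 3) 3
      simp [Nat.descFactorial, Nat.factorial] at h3
      have h4 : (((m + 1) * ((m + 2) * (m + 3)) : ℕ) : ℝ) = ((6 * (m + 3).choose 3 : ℕ) : ℝ) := by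
        rw [← h3]
      push_cast at h4
      linarith
    push_cast
    rw [pow_succ]
    linear_combination (-(1/3) * y ^ m * y) * this
  · ring

/-- The generating identity, near the origin. -/
lemma tsum_mul_truncExp_of_small {y : ℝ} (hy : |y| < 1 / 8) :
    ∑' n : ℕ, (n : ℝ) * truncExp n * (y * Real.exp (-y)) ^ n = 2 * y / (1 - y) ^ 4 := by
  let f : ℕ × ℕ → ℝ := fun p =>
    (p.1 : ℝ) * truncExp p.1 * y ^ p.1 * ((-((p.1 : ℝ) * y)) ^ p.2 / p.2.factorial)
  have hexp : ∀ x : ℝ, HasSum (fun k : ℕ => x ^ k / k.factorial) (Real.exp x) := fun x => by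
    rw [Real.exp_eq_exp_ℝ]; exact NormedSpace.expSeries_div_hasSum_exp x
  have hnorm : ∀ p, ‖f p‖ = (p.1 : ℝ) * truncExp p.1 * |y| ^ p.1 *
      (((p.1 : ℝ) * |y|) ^ p.2 / p.2.factorial) := by
    intro p
    simp [f, abs_of_nonneg (truncExp_nonneg _)]
  have hsum : Summable f := by
    refine Summable.of_norm ?_
    rw [summable_prod_of_nonneg (fun _ => norm_nonneg _)]
    simp only [hnorm]
    refine ⟨fun n => (hexp _).summable.mul_left _, ?_⟩
    simp only [fun n : ℕ => ((hexp (n * |y|)).mul_left ((n : ℝ) * truncExp n * |y| ^ n)).tsum_eq]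
    -- The radius 1/8 works because e² < 8.
    have hr : Real.exp 1 * (|y| * Real.exp |y|) < 1 := by
      have h1 : Real.exp |y| ≤ Real.exp 1 := Real.exp_le_exp.mpr (by linarith)
      have h2 := Real.exp_one_lt_d9
      have h3 := Real.exp_pos 1
      have h4 : Real.exp 1 * (|y| * Real.exp |y|) ≤ Real.exp 1 * (1 / 8 * Real.exp 1) := by gcongr
      nlinarith
    refine (summable_mul_truncExp_mul_pow (by positivity) hr).congr fun n => ?_
    rw [mul_pow, ← Real.exp_nat_mul]
    ring
  have hL : HasSum f (∑' n : ℕ, (n : ℝ) * truncExp n * (y * Real.exp (-y)) ^ n) := by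
    have h := hsum.hasSum
    rw [hsum.tsum_prod] at h
    convert! h using 3 with n
    simp only [f]
    rw [((hexp (-((n : ℝ) * y))).mul_left _).tsum_eq, mul_pow, ← Real.exp_nat_mul]
    ring_nf
  -- Regroup the double series by total degree m in y.
  have h2 := (Finset.HasAntidiagonal.sigmaAntidiagonalEquivProd (A := ℕ)).hasSum_iff.mpr hL
  have h3 := h2.sigma (fun m => hasSum_fintype _)
  refine h3.unique ?_
  convert! hasSum_cubic_mul_geometric (y := y) (by linarith) using 1
  ext m
  rw [← sum_mul_truncExp_mul_neg_pow, Finset.sum_mul]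
  simp only [Function.comp]
  change ∑ x : Finset.HasAntidiagonal.antidiagonal m, f x = _
  rw [Finset.sum_coe_sort (Finset.HasAntidiagonal.antidiagonal m) f,
    Finset.Nat.sum_antidiagonal_eq_sum_range_succ_mk]
  refine Finset.sum_congr rfl fun n hn => ?_
  have hn' : n ≤ m := by simpa [Nat.lt_succ_iff] using hn
  obtain ⟨k, rfl⟩ := Nat.exists_eq_add_of_le hn'
  simp only [f, Nat.add_sub_cancel_left]
  rw [neg_pow, mul_pow, pow_add, neg_pow (n : ℝ)]
  ring

lemma analyticAt_tsum_mul_truncExp {z : ℝ} (hz : Real.exp 1 * |z| < 1) :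
    AnalyticAt ℝ (fun z : ℝ => ∑' n : ℕ, (n : ℝ) * truncExp n * z ^ n) z := by
  let p := FormalMultilinearSeries.ofScalars ℝ (fun n : ℕ => (n : ℝ) * truncExp n)
  obtain ⟨r, hr1, hr2⟩ := exists_between ((lt_div_iff₀' (Real.exp_pos 1)).mpr hz)
  have hr0 : 0 ≤ r := (abs_nonneg z).trans hr1.le
  lift r to NNReal using hr0
  have hp : (r : ENNReal) ≤ p.radius := by
    apply p.le_radius_of_summable
    refine (summable_mul_truncExp_mul_pow r.coe_nonneg
      ((lt_div_iff₀' (Real.exp_pos 1)).mp hr2)).congr fun n => ?_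
    simp [p, abs_of_nonneg (truncExp_nonneg _)]
  have hzr : ‖z‖₊ < r := by
    rw [← NNReal.coe_lt_coe]; simpa using hr1
  have hz' : (‖z‖₊ : ENNReal) < p.radius := lt_of_lt_of_le (by exact_mod_cast hzr) hp
  have h := (p.hasFPowerSeriesOnBall (zero_le.trans_lt hz')).analyticAt_of_mem
    (y := z) (by simpa [edist_zero_right, enorm] using hz')
  convert! h using 1
  ext x
  simp [p, FormalMultilinearSeries.sum, mul_comm]

/-- The generating identity `∑ n c_n z^n = 2y / (1 - y)^4` for `z = y e^{-y}`. -/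
lemma tsum_mul_truncExp {y : ℝ} (hy : y ∈ Set.Ioo (0 : ℝ) 1) :
    ∑' n : ℕ, (n : ℝ) * truncExp n * (y * Real.exp (-y)) ^ n = 2 * y / (1 - y) ^ 4 := by
  -- The values x e^(-x) stay inside the disc |z| < 1/e: for x ≥ 0 because x < e^(x-1) when x ≠ 1,
  -- for x < 0 because e² < 8.
  have hbound : ∀ x ∈ Set.Ioo (-1 / 8 : ℝ) 1, Real.exp 1 * |x * Real.exp (-x)| < 1 := by
    rintro x ⟨h1, h2⟩
    rw [abs_mul, Real.abs_exp]
    rcases le_or_gt 0 x with hx | hx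
    · rw [abs_of_nonneg hx, mul_left_comm, ← Real.exp_add]
      have h3 := Real.add_one_lt_exp (x := x - 1) (by linarith)
      have h4 : Real.exp (x - 1) * Real.exp (1 + -x) = 1 := by
        rw [← Real.exp_add, show x - 1 + (1 + -x) = 0 by ring, Real.exp_zero]
      have h5 := Real.exp_pos (1 + -x)
      nlinarith
    · rw [abs_of_neg hx]
      have h3 : Real.exp (-x) ≤ Real.exp 1 := Real.exp_le_exp.mpr (by linarith)
      have h4 := Real.exp_one_lt_d9
      have h5 := Real.exp_pos 1
      have h6 : Real.exp 1 * (-x * Real.exp (-x)) ≤ Real.exp 1 * (1 / 8 * Real.exp 1) := by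
        gcongr
        linarith
      nlinarith
  have hL : AnalyticOnNhd ℝ
      (fun y : ℝ => ∑' n : ℕ, (n : ℝ) * truncExp n * (y * Real.exp (-y)) ^ n)
      (Set.Ioo (-1 / 8) 1) := fun x hx =>
    (analyticAt_tsum_mul_truncExp (hbound x hx)).fun_comp (f := fun y : ℝ => y * Real.exp (-y))
      (by fun_prop)
  have hR : AnalyticOnNhd ℝ (fun y : ℝ => 2 * y / (1 - y) ^ 4) (Set.Ioo (-1 / 8) 1) :=
    fun x hx => by
      have : (1 - x) ^ 4 ≠ 0 := pow_ne_zero _ (by linarith [hx.2])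
      exact AnalyticAt.div (by fun_prop) (by fun_prop) this
  refine hL.eqOn_of_preconnected_of_eventuallyEq hR isPreconnected_Ioo (z₀ := 0)
    (by norm_num) ?_ ⟨by linarith [hy.1], hy.2⟩
  filter_upwards [Metric.ball_mem_nhds (0 : ℝ) (show (0 : ℝ) < 1 / 8 by norm_num)] with x hx
  exact tsum_mul_truncExp_of_small (by simpa using hx)

/-! ### Termwise Mellin integrals -/

-- Tonelli bounds the norm; pointwise summability gives measurability, as a limit of partial sums.
open MeasureTheory Set in
lemma integrable_tsum_of_summable_integral_norm {α E ι : Type*} [MeasurableSpace α]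
    {μ : Measure α} [NormedAddCommGroup E] [NormedSpace ℝ E] [CompleteSpace E] [Countable ι]
    {F : ι → α → E} (hF_int : ∀ i, Integrable (F i) μ)
    (hF_sum : Summable fun i => ∫ a, ‖F i a‖ ∂μ) (hF : ∀ᵐ a ∂μ, Summable fun i => F i a) :
    Integrable (fun a => ∑' i, F i a) μ := by
  refine ⟨aestronglyMeasurable_of_tendsto_ae Filter.atTop
    (f := fun (s : Finset ι) a => ∑ i ∈ s, F i a)
    (fun s => Finset.aestronglyMeasurable_fun_sum s fun i _ => (hF_int i).1)
    (hF.mono fun a ha => ha.hasSum), ?_⟩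
  have h (i : ι) : ∫⁻ a, ‖F i a‖ₑ ∂μ = ENNReal.ofReal (∫ a, ‖F i a‖ ∂μ) :=
    (ofReal_integral_norm_eq_lintegral_enorm (hF_int i)).symm
  calc ∫⁻ a, ‖∑' i, F i a‖ₑ ∂μ ≤ ∫⁻ a, ∑' i, ‖F i a‖ₑ ∂μ :=
        lintegral_mono fun a => enorm_tsum_le_tsum_enorm
    _ = ∑' i, ∫⁻ a, ‖F i a‖ₑ ∂μ := lintegral_tsum fun i => (hF_int i).1.enorm
    _ = ∑' i, ENNReal.ofReal (∫ a, ‖F i a‖ ∂μ) := by simp_rw [h]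
    _ < ⊤ := hF_sum.tsum_ofReal_lt_top

/-- Here 0^s = 0 and division by zero gives 0, so sums over ℕ and over positive integers agree. -/
lemma MTerm_zero {s : ℂ} (hs : 1 < s.re) : MTerm s 0 = 0 := by
  have : s ≠ 0 := by rintro rfl; simp at hs; linarith
  simp [MTerm, Complex.zero_cpow this]

lemma MTerm_eq (s : ℂ) (n : ℕ) :
    MTerm s n = ((Real.exp (-(n : ℝ)) * truncExp n : ℝ) : ℂ) / (n : ℂ) ^ s := by
  simp only [MTerm, truncExp]
  push_cast
  ring

lemma norm_MTerm_le {s : ℂ} (hs : 1 < s.re) (n : ℕ) : ‖MTerm s n‖ ≤ 1 / (n : ℝ) ^ s.re := by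
  rcases Nat.eq_zero_or_pos n with rfl | hn
  · rw [MTerm_zero hs]; simp [Real.zero_rpow (by linarith : s.re ≠ 0)]
  · rw [MTerm_eq, norm_div, Complex.norm_natCast_cpow_of_pos hn, Complex.norm_real,
      Real.norm_of_nonneg (mul_nonneg (Real.exp_pos _).le (truncExp_nonneg n))]
    gcongr
    calc Real.exp (-n) * truncExp n ≤ Real.exp (-n) * Real.exp n := by
          gcongr; exact truncExp_le_exp n
      _ = 1 := by rw [← Real.exp_add]; simp

lemma summable_MTerm {s : ℂ} (hs : 1 < s.re) : Summable (MTerm s) :=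
  Summable.of_norm_bounded (Real.summable_one_div_nat_rpow.mpr hs) (norm_MTerm_le hs)

/-- The Mellin kernel `x^s n c_n e^{-n(1+x)}` attached to the `n`-th term. -/
noncomputable def mellinTerm (s : ℂ) (n : ℕ) (x : ℝ) : ℂ :=
  (x : ℂ) ^ s * ((n * truncExp n * Real.exp (-n) * Real.exp (-(n * x)) : ℝ) : ℂ)

lemma norm_mellinTerm (s : ℂ) (n : ℕ) {x : ℝ} (hx : 0 < x) :
    ‖mellinTerm s n x‖ =
      (n * truncExp n * Real.exp (-n)) * (x ^ s.re * Real.exp (-(n * x))) := by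
  have := truncExp_nonneg n
  rw [mellinTerm, norm_mul, Complex.norm_cpow_eq_rpow_re_of_pos hx, Complex.norm_real,
    Real.norm_of_nonneg (by positivity)]
  ring

open MeasureTheory Set in
lemma integrableOn_mellinTerm {s : ℂ} (hs : 1 < s.re) (n : ℕ) :
    IntegrableOn (mellinTerm s n) (Ioi 0) := by
  rcases Nat.eq_zero_or_pos n with rfl | hn
  · have : mellinTerm s 0 = fun _ => 0 := by ext x; simp [mellinTerm]
    rw [this]; exact integrableOn_zero
  · have h := (integrableOn_rpow_mul_exp_neg_mul_rpow (p := 1) (s := s.re) (b := n)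
      (by linarith) one_pos (by exact_mod_cast hn)).const_mul (n * truncExp n * Real.exp (-n))
    refine Integrable.mono' h ?_ ?_
    · refine ContinuousOn.aestronglyMeasurable ?_ measurableSet_Ioi
      intro x hx
      have hx' : (x : ℂ) ∈ Complex.slitPlane := by simpa using hx
      refine ContinuousAt.continuousWithinAt ?_
      unfold mellinTerm
      exact (ContinuousAt.cpow (f := fun x : ℝ => (x : ℂ)) (by fun_prop) continuousAt_const hx').mul
        (by fun_prop)
    · filter_upwards [ae_restrict_mem measurableSet_Ioi] with x hx
      rw [norm_mellinTerm s n hx]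
      simp

open MeasureTheory Set in
lemma integral_mellinTerm {s : ℂ} (hs : 1 < s.re) (n : ℕ) :
    ∫ x in Ioi 0, mellinTerm s n x = Complex.Gamma (1 + s) * MTerm s n := by
  rcases Nat.eq_zero_or_pos n with rfl | hn
  · simp [MTerm_zero hs, mellinTerm]
  · have hn0 : (n : ℂ) ≠ 0 := by exact_mod_cast hn.ne'
    have h := Complex.integral_cpow_mul_exp_neg_mul_Ioi (a := s + 1) (r := (n : ℝ))
      (by simp; linarith) (by exact_mod_cast hn)
    rw [add_sub_cancel_right] at h
    have e : ∀ x : ℝ, mellinTerm s n x = ((n * truncExp n * Real.exp (-n) : ℝ) : ℂ) *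
        ((x : ℂ) ^ s * Complex.exp (-((n : ℝ) * x))) := by
      intro x
      simp only [mellinTerm]
      push_cast
      ring
    simp_rw [e]
    rw [integral_const_mul, h, MTerm_eq, add_comm 1 s, Complex.ofReal_natCast, one_div,
      Complex.inv_cpow _ _ (by rw [Complex.natCast_arg]; exact Real.pi_pos.ne),
      Complex.cpow_add _ _ hn0, Complex.cpow_one]
    push_cast
    field_simp

-- On x > 0 the norm of the kernel is the kernel at the real exponent Re s, so its integral is
-- already known.
open MeasureTheory Set in
lemma summable_integral_norm_mellinTerm {s : ℂ} (hs : 1 < s.re) :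
    Summable fun n : ℕ => ∫ x in Ioi 0, ‖mellinTerm s n x‖ := by
  have h : ∀ n : ℕ, ∫ x in Ioi 0, ‖mellinTerm s n x‖ =
      ‖Complex.Gamma (1 + s.re) * MTerm s.re n‖ := by
    intro n
    rw [← integral_mellinTerm (s := s.re) (by simpa using hs), ← Complex.norm_of_nonneg
      (integral_nonneg fun x => norm_nonneg (mellinTerm s n x)), ← integral_complex_ofReal]
    congr 1
    refine setIntegral_congr_fun measurableSet_Ioi fun x hx => ?_
    rw [norm_mellinTerm s n hx, mellinTerm, ← Complex.ofReal_cpow (le_of_lt hx)]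
    push_cast
    ring
  simp_rw [h]
  exact ((summable_MTerm (s := s.re) (by simpa using hs)).mul_left _).norm

/-! ### Change of variables -/

/-- The substitution `x = -t - log (1 - t)`. -/
noncomputable def logSub (t : ℝ) : ℝ := -t - Real.log (1 - t)

lemma hasDerivAt_logSub {t : ℝ} (ht : t < 1) : HasDerivAt logSub (t / (1 - t)) t := by
  have h1 : (1 - t) ≠ 0 := by linarith
  have h := ((hasDerivAt_id t).neg).sub (((hasDerivAt_id t).const_sub 1).log h1)
  convert! h using 1
  simp only [id]
  field_simp
  ring

lemma continuousOn_logSub : ContinuousOn logSub (Set.Iio 1) := fun _ ht =>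
  (hasDerivAt_logSub ht).continuousAt.continuousWithinAt

lemma strictMonoOn_logSub : StrictMonoOn logSub (Set.Ico 0 1) := by
  refine strictMonoOn_of_deriv_pos (convex_Ico 0 1)
    (continuousOn_logSub.mono fun x hx => hx.2) fun x hx => ?_
  rw [interior_Ico] at hx
  rw [(hasDerivAt_logSub hx.2).deriv]
  exact div_pos hx.1 (by linarith [hx.2])

lemma logSub_pos {t : ℝ} (ht : t ∈ Set.Ioo (0 : ℝ) 1) : 0 < logSub t := by
  have h := strictMonoOn_logSub ⟨le_rfl, one_pos⟩ ⟨ht.1.le, ht.2⟩ ht.1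
  simpa [logSub] using h

open Set Filter in
lemma image_logSub : logSub '' Ioo 0 1 = Ioi 0 := by
  refine Subset.antisymm (image_subset_iff.mpr fun t ht => logSub_pos ht) fun x hx => ?_
  have hx' : (0 : ℝ) < x := hx
  -- Chosen so that log(1-b) = -(x+1), whence `logSub b` = x + 1 - b > x.
  let b : ℝ := 1 - Real.exp (-(x + 1))
  have hb1 : b < 1 := by simp only [b]; linarith [Real.exp_pos (-(x + 1))]
  have hb0 : 0 < b := by
    have : Real.exp (-(x + 1)) < 1 := Real.exp_lt_one_iff.mpr (by linarith)
    simp only [b]; linarith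
  have hbx : x < logSub b := by
    have : logSub b = -b + (x + 1) := by
      simp only [logSub, b, sub_sub_cancel, Real.log_exp]
      ring
    rw [this]; linarith
  have h := intermediate_value_Ioo hb0.le
    (continuousOn_logSub.mono fun t ht => lt_of_le_of_lt ht.2 hb1)
  obtain ⟨t, ht, rfl⟩ := h ⟨by simpa [logSub] using hx', hbx⟩
  exact ⟨t, ⟨ht.1, ht.2.trans hb1⟩, rfl⟩

lemma mul_truncExp_mul_exp_logSub {t : ℝ} (ht : t < 1) (n : ℕ) :
    n * truncExp n * Real.exp (-n) * Real.exp (-(n * logSub t)) =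
      n * truncExp n * ((1 - t) * Real.exp (-(1 - t))) ^ n := by
  have h : (1 - t) * Real.exp (-(1 - t)) = Real.exp (-1 - logSub t) := by
    rw [← Real.exp_log (by linarith : 0 < 1 - t), ← Real.exp_add,
      Real.exp_log (by linarith : 0 < 1 - t)]
    congr 1
    simp only [logSub]
    ring
  rw [h, ← Real.exp_nat_mul, mul_assoc, ← Real.exp_add]
  ring_nf

lemma tsum_mellinTerm_logSub (s : ℂ) {t : ℝ} (ht : t ∈ Set.Ioo (0 : ℝ) 1) :
    ∑' n : ℕ, mellinTerm s n (logSub t) =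
      (logSub t : ℂ) ^ s * ((2 * (1 - t) / t ^ 4 : ℝ) : ℂ) := by
  simp only [mellinTerm, mul_truncExp_mul_exp_logSub ht.2]
  rw [tsum_mul_left, ← Complex.ofReal_tsum,
    tsum_mul_truncExp ⟨by linarith [ht.2], by linarith [ht.1]⟩, sub_sub_cancel]

lemma summable_mellinTerm (s : ℂ) {x : ℝ} (hx : 0 < x) :
    Summable fun n : ℕ => mellinTerm s n x := by
  have hr : Real.exp 1 * Real.exp (-(1 + x)) < 1 := by
    rw [← Real.exp_add]; exact Real.exp_lt_one_iff.mpr (by linarith)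
  refine Summable.mul_left _ (Complex.summable_ofReal.mpr ?_)
  refine (summable_mul_truncExp_mul_pow (Real.exp_pos _).le hr).congr fun n => ?_
  rw [← Real.exp_nat_mul, mul_assoc (_ * _), ← Real.exp_add]
  ring_nf

lemma abs_deriv_smul_tsum_mellinTerm (s : ℂ) {t : ℝ} (ht : t ∈ Set.Ioo (0 : ℝ) 1) :
    |t / (1 - t)| • ∑' n : ℕ, mellinTerm s n (logSub t) =
      2 * ((logSub t : ℂ) ^ s / (t : ℂ) ^ 3) := by
  have h0 : (t : ℂ) ≠ 0 := by exact_mod_cast ht.1.ne'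
  have h1 : (1 - t : ℂ) ≠ 0 := by exact_mod_cast (by linarith [ht.2] : (1 - t : ℝ) ≠ 0)
  rw [tsum_mellinTerm_logSub s ht, abs_of_nonneg (div_nonneg ht.1.le (by linarith [ht.2])),
    Complex.real_smul]
  push_cast
  field_simp

open MeasureTheory Set in
theorem theorem1p1 (s : ℂ) (hs : 1 < s.re) :
    Summable (fun n : ℕ+ => MTerm s n) ∧
    IntervalIntegrable
      (fun t : ℝ => ((-t - Real.log (1 - t) : ℝ) : ℂ) ^ s / (t : ℂ) ^ 3)
      MeasureTheory.volume 0 1 ∧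
    1 / 2 * Complex.Gamma (1 + s) * MFun s =
      ∫ t in (0 : ℝ)..1, ((-t - Real.log (1 - t) : ℝ) : ℂ) ^ s / (t : ℂ) ^ 3 := by
  have hderiv : ∀ t ∈ Ioo (0 : ℝ) 1, HasDerivWithinAt logSub (t / (1 - t)) (Ioo 0 1) t :=
    fun t ht => (hasDerivAt_logSub ht.2).hasDerivWithinAt
  have hinj : InjOn logSub (Ioo 0 1) := (strictMonoOn_logSub.mono Ioo_subset_Ico_self).injOn
  have hcongr : EqOn (fun t => |t / (1 - t)| • ∑' n : ℕ, mellinTerm s n (logSub t))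
      (fun t => 2 * ((logSub t : ℂ) ^ s / (t : ℂ) ^ 3)) (Ioo 0 1) :=
    fun t ht => abs_deriv_smul_tsum_mellinTerm s ht
  have hsum := summable_MTerm hs
  refine ⟨hsum.comp_injective PNat.coe_injective, ?_, ?_⟩
  · have h : IntegrableOn (fun x => ∑' n : ℕ, mellinTerm s n x) (Ioi 0) :=
      integrable_tsum_of_summable_integral_norm (integrableOn_mellinTerm hs)
        (summable_integral_norm_mellinTerm hs)
        ((ae_restrict_mem measurableSet_Ioi).mono fun x hx => summable_mellinTerm s hx)
    -- Integrability of the summed kernel in x transfers to the integrand in t.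
    rw [← image_logSub, integrableOn_image_iff_integrableOn_abs_deriv_smul measurableSet_Ioo
      hderiv hinj, integrableOn_congr_fun hcongr measurableSet_Ioo] at h
    rw [intervalIntegrable_iff_integrableOn_Ioo_of_le zero_le_one]
    exact (h.const_mul (1 / 2)).congr (.of_forall fun t => by simp [logSub])
  · have h := hasSum_integral_of_summable_integral_norm (integrableOn_mellinTerm hs)
      (summable_integral_norm_mellinTerm hs)
    rw [← image_logSub, integral_image_eq_integral_abs_deriv_smul measurableSet_Ioo
      hderiv hinj, setIntegral_congr_fun measurableSet_Ioo hcongr, integral_const_mul,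
      image_logSub] at h
    simp_rw [integral_mellinTerm hs] at h
    have hM : MFun s = ∑' n : ℕ, MTerm s n :=
      PNat.coe_injective.tsum_eq fun n hn => by
        have : n ≠ 0 := by rintro rfl; exact hn (MTerm_zero hs)
        exact ⟨⟨n, Nat.pos_of_ne_zero this⟩, rfl⟩
    have h2 := h.unique (hsum.hasSum.mul_left _)
    rw [intervalIntegral.integral_of_le zero_le_one, integral_Ioc_eq_integral_Ioo, hM, mul_assoc,
      ← h2, ← mul_assoc]
    norm_num [logSub]
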